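/- Throughout, $\log$ is the logarithm to base $2$ and $Q(x)=\Pr(N(0,1)>x)$. A memoryless binary synchronization error channel is given by two probability laws $p(\cdot\mid 0),p(\cdot\mid 1)$ on the set of finite (possibly empty) binary strings: on input $X=(X_1,\dots,X_n)\in\{0,1\}^n$ each bit $X_i$ is independently replaced by a random string of law $p(\cdot\mid X_i)$, and the output $Y$ is the concatenation of these strings (without any marker of their boundaries). Let $M$ be the length of $Y$. The AWGN/synch channel is the cascade of this channel with a BPSK AWGN channel: its output $\widetilde Y$ has the same length $M$, and $\widetilde Y_j=(1-2Y_j)+Z_j$, where the $Z_j$ are i.i.d. $N(0,\sigma^2)$, $\sigma>0$, independent of everything else. The capacities (in bits per transmitted bit) are $$C_s=\lim_{n\to\infty}\frac1n\sup_{P(X)}I(X;Y),\qquad C_{As}=\lim_{n\to\infty}\frac1n\sup_{P(X)}I(X;\widetilde Y),$$ the suprema being over all laws $P(X)$ on $\{0,1\}^n$. Call $r\in[0,\infty)$ an output rate of the synchronization error channel if $r=\lim_k E\{M\}/n_k$ for some block lengths $n_k\to\infty$ and some capacity achieving input laws $P_k$ on $\{0,1\}^{n_k}$, i.e. laws with $\frac1{n_k}I(X;Y)\to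 C_s$. Theorem. For every memoryless binary synchronization error channel the limit $C_s$ exists and is finite, and: (1) for every $\sigma>0$ the limit $C_{As}$ exists and is finite, and for every output rate $r$ $$C_{As}\ \ge\ C_s-r\left[\log(e)\left(\frac{2}{\sqrt{2\pi}\,\sigma}e^{-\frac1{2\sigma^2}}-\frac2{\sigma^2}Q\!\left(\frac1\sigma\right)\right)+\log\left(1+Q\!\left(\frac1\sigma\right)+e^{\frac4{\sigma^2}}Q\!\left(\frac3\sigma\right)\right)\right];$$ (2) for every fixed $r\ge 0$, the right-hand side of this bound tends to $C_s$ as $\sigma\to0^+$; (3) if both laws $p(\cdot\mid 0)$, $p(\cdot\mid 1)$ have finite mean string length, then an output rate $r$ exists; if both have the same finite mean string length $\ell$, then $r=\ell$ is the one and only output rate. -/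

import Mathlib

open MeasureTheory ProbabilityTheory Filter Topology
open scoped ENNReal NNReal

noncomputable section

namespace SyncChannel

/-- Finite strings (possibly empty) over an alphabet `α`: a length together with the symbols.
As a measurable space it is the disjoint union of the spaces `Fin m → α`. -/
abbrev Word (α : Type) : Type := Σ m : ℕ, (Fin m → α)

/-- The empty string. -/
def Word.nil {α : Type} : Word α := ⟨0, Fin.elim0⟩

/-- Concatenation of strings. -/
def Word.append {α : Type} (s t : Word α) : Word α := ⟨s.1 + t.1, Fin.append s.2 t.2⟩

instance Word.instMeasurableSingletonClass {α : Type} [MeasurableSpace α]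
    [MeasurableSingletonClass α] : MeasurableSingletonClass (Word α) where
  measurableSet_singleton w := by
    refine MeasurableSpace.measurableSet_iInf.2 fun a => ?_
    change MeasurableSet (Sigma.mk a ⁻¹' {w})
    refine Set.Subsingleton.measurableSet fun x hx y hy => ?_
    have hx' : (⟨a, x⟩ : Word α) = w := hx
    have hy' : (⟨a, y⟩ : Word α) = w := hy
    exact eq_of_heq (Sigma.mk.inj (hx'.trans hy'.symm)).2

/-! ### The memoryless synchronization error channel -/

/-- Law of the received string when the bits of a list are sent: each bit `b` is replaced,
independently of the others, by a random binary string with law `p b`, and the resulting strings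
are concatenated without any marker of their boundaries. -/
def syncOutput (p : Bool → PMF (Word Bool)) : List Bool → PMF (Word Bool)
  | [] => PMF.pure Word.nil
  | b :: x => (p b).bind fun s => (syncOutput p x).map fun t => s.append t

/-- The synchronization error channel with inputs of length `n`. -/
def syncChannel (p : Bool → PMF (Word Bool)) (n : ℕ) : Kernel (Fin n → Bool) (Word Bool) :=
  Kernel.ofFunOfCountable fun x => (syncOutput p (List.ofFn x)).toMeasure

instance (p : Bool → PMF (Word Bool)) (n : ℕ) : IsMarkovKernel (syncChannel p n) :=
  ⟨fun x => by
    change IsProbabilityMeasure (syncOutput p (List.ofFn x)).toMeasure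
    infer_instance⟩

/-! ### The binary-input additive white Gaussian noise channel and the cascade -/

/-- BPSK modulation `b ↦ 1 - 2 b` of a bit. -/
def bpsk (b : Bool) : ℝ := if b then -1 else 1

/-- The memoryless AWGN channel on strings: the length is kept, every bit is BPSK modulated, and
i.i.d. centred Gaussian noise of variance `σ ^ 2` is added to the symbols. -/
def awgnChannel (σ : ℝ) : Kernel (Word Bool) (Word ℝ) :=
  Kernel.ofFunOfCountable fun y =>
    (Measure.pi fun i : Fin y.1 => gaussianReal (bpsk (y.2 i)) (Real.toNNReal (σ ^ 2))).map
      fun z => (⟨y.1, z⟩ : Word ℝ)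

theorem measurable_wordMk {α : Type} [MeasurableSpace α] (m : ℕ) :
    Measurable (fun z : Fin m → α => (⟨m, z⟩ : Word α)) :=
  fun _ hs => MeasurableSpace.measurableSet_iInf.1 hs m

instance (σ : ℝ) : IsMarkovKernel (awgnChannel σ) :=
  ⟨fun y => Measure.isProbabilityMeasure_map (measurable_wordMk y.1).aemeasurable⟩

/-- The AWGN/synch channel with inputs of length `n`: the cascade of the synchronization error
channel and the AWGN channel. -/
def awgnSyncChannel (p : Bool → PMF (Word Bool)) (σ : ℝ) (n : ℕ) :
    Kernel (Fin n → Bool) (Word ℝ) :=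
  awgnChannel σ ∘ₖ syncChannel p n

/-! ### Mutual information and capacity, in bits -/

/-- Mutual information `I(X; Y)` in bits between an input `X` of law `μ` and the output `Y` of the
channel `κ`: the relative entropy of the joint law with respect to the product of its marginals. -/
def mutualInfo {α β : Type} [MeasurableSpace α] [MeasurableSpace β]
    (μ : Measure α) (κ : Kernel α β) : ℝ≥0∞ :=
  InformationTheory.klDiv (μ ⊗ₘ κ) (μ.prod (κ ∘ₘ μ)) / ENNReal.ofReal (Real.log 2)

/-- The largest mutual information over all laws of a binary input of length `n`. -/
def blockCapacity {β : Type} [MeasurableSpace β] (W : ∀ n : ℕ, Kernel (Fin n → Bool) β)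
    (n : ℕ) : ℝ≥0∞ :=
  ⨆ P : PMF (Fin n → Bool), mutualInfo P.toMeasure (W n)

/-- `C = lim (1 / n) max_{P(X)} I(X; Y)`, in bits per channel use; this includes that the limit
exists and is finite. -/
def HasCapacity {β : Type} [MeasurableSpace β] (W : ∀ n : ℕ, Kernel (Fin n → Bool) β)
    (C : ℝ≥0) : Prop :=
  Tendsto (fun n : ℕ => blockCapacity W n / (n : ℝ≥0∞)) atTop (𝓝 (C : ℝ≥0∞))

/-! ### Output rate -/

/-- Expected length of a random string. -/
def meanLength (μ : Measure (Word Bool)) : ℝ≥0∞ := ∫⁻ w, (w.1 : ℝ≥0∞) ∂μ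

/-- `r = lim E{M} / n`, where `M` is the length of the received string when the input of the
synchronization error channel (of capacity `Cs`) follows capacity achieving laws `P k` of block
lengths `n k → ∞`. -/
def IsOutputRate (p : Bool → PMF (Word Bool)) (Cs r : ℝ≥0) : Prop :=
  ∃ (n : ℕ → ℕ) (P : ∀ k, PMF (Fin (n k) → Bool)),
    Tendsto n atTop atTop ∧
    Tendsto (fun k => mutualInfo (P k).toMeasure (syncChannel p (n k)) / (n k : ℝ≥0∞))
      atTop (𝓝 (Cs : ℝ≥0∞)) ∧
    Tendsto (fun k => meanLength (syncChannel p (n k) ∘ₘ (P k).toMeasure) / (n k : ℝ≥0∞))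
      atTop (𝓝 (r : ℝ≥0∞))

/-! ### The bound -/

/-- Right tail probability of the standard normal distribution. -/
def Q (x : ℝ) : ℝ := (gaussianReal 0 1).real (Set.Ioi x)

/-- The loss, in bits per received symbol, in the lower bound for noise of variance `σ ^ 2`. -/
def awgnLoss (σ : ℝ) : ℝ :=
  Real.logb 2 (Real.exp 1) *
      (2 / (√(2 * Real.pi) * σ) * Real.exp (-(1 / (2 * σ ^ 2))) - 2 / σ ^ 2 * Q (1 / σ)) +
    Real.logb 2 (1 + Q (1 / σ) + Real.exp (4 / σ ^ 2) * Q (3 / σ))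

end SyncChannel

end

/-! Fix a block length and an input law, and let `Z` be the noisy version of `Y`. Data processing
and the chain rule give `I(X;Y) ≤ I(X;Y,Z) = I(X;Z) + I(X;Y|Z)`, and the last term is at most the
expected self-information `-log R(Y|Z)` of any guess `R` of `Y` from `Z`
(`klDiv_le_klDiv_cascade_add`). Everything is phrased with relative entropies, so no densities or
conditional entropies of `Z` are needed.

Take for `R` the posterior of independent uniform bits. It need not be the true posterior, but it is
a product, and by the symmetry of BPSK each symbol contributes the same amount `symbolLoss σ`,
whatever the bit. The loss is therefore `E{M}` times a constant (`mutualInfo_syncChannel_le`).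
Splitting at the decision threshold and applying Jensen's inequality to `log (1 + u)` bounds that
constant by `awgnLoss σ` in bits (`symbolLoss_le`). Dividing by the block length and passing to the
limit along capacity achieving laws gives the bound.

Both capacities exist by Fekete's lemma: the output of a joined block is a function of the outputs
of its two parts, so block capacity is subadditive (`blockCapacity_add_le`). Gaussian tail estimates
make the loss vanish with `σ`. Output rates come from compactness and from additivity of the mean
length over input bits. -/

namespace SyncChannel

open InformationTheory

/-! ### Relative entropy: chain rule, averaging and density bounds -/

section KullbackLeibler

variable {α β γ : Type} [MeasurableSpace α] [MeasurableSpace β] [MeasurableSpace γ]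

theorem klDiv_map_measurableEquiv (e : α ≃ᵐ β) (μ ν : Measure α) [IsFiniteMeasure μ]
    [IsFiniteMeasure ν] : klDiv (μ.map e) (ν.map e) = klDiv μ ν := by
  refine le_antisymm (klDiv_map_le _ _ e.measurable) ?_
  have h := klDiv_map_le (μ.map e) (ν.map e) e.symm.measurable
  simpa [Measure.map_map e.symm.measurable e.measurable] using h

theorem klDiv_map_swap (μ ν : Measure (α × β)) [IsFiniteMeasure μ] [IsFiniteMeasure ν] :
    klDiv (μ.map Prod.swap) (ν.map Prod.swap) = klDiv μ ν :=
  klDiv_map_measurableEquiv MeasurableEquiv.prodComm μ ν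

/-- The chain rule leaves a second term with common first factor `a`; after a swap, `a` becomes a
common kernel and drops out. -/
theorem klDiv_prod (a c : Measure α) (b d : Measure β) [IsProbabilityMeasure a]
    [IsProbabilityMeasure b] [IsProbabilityMeasure c] [IsProbabilityMeasure d] :
    klDiv (a.prod b) (c.prod d) = klDiv a c + klDiv b d := by
  have h := klDiv_compProd_eq_add a c (Kernel.const α b) (Kernel.const α d)
  simp only [Measure.compProd_const] at h
  rw [h]
  congr 1
  rw [← klDiv_map_swap]
  simp only [Measure.prod_swap]
  have h2 := klDiv_compProd_left b d (Kernel.const β a)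
  simpa only [Measure.compProd_const] using h2

theorem compProd_eq_withDensity_rnDeriv [Countable α]
    {μ : Measure α} [IsFiniteMeasure μ] {κ η : Kernel α β} [IsFiniteKernel κ] [IsFiniteKernel η]
    (h : ∀ᵐ x ∂μ, κ x ≪ η x) :
    μ ⊗ₘ κ = (μ ⊗ₘ η).withDensity (Function.uncurry (Kernel.rnDeriv κ η)) := by
  refine Measure.ext_of_lintegral _ fun g hg => ?_
  have hm : Measurable (Function.uncurry (Kernel.rnDeriv κ η)) := Kernel.measurable_rnDeriv κ η
  rw [lintegral_withDensity_eq_lintegral_mul _ hm hg, Measure.lintegral_compProd hg,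
    Measure.lintegral_compProd (hm.mul hg)]
  refine lintegral_congr_ae (h.mono fun x hx => ?_)
  have h1 : κ x = (η x).withDensity (Kernel.rnDeriv κ η x) := by
    conv_lhs => rw [← Measure.withDensity_rnDeriv_eq _ _ hx]
    exact withDensity_congr_ae Kernel.rnDeriv_eq_rnDeriv_measure.symm
  have hgx : Measurable fun y => g (x, y) := hg.comp measurable_prodMk_left
  change ∫⁻ y, g (x, y) ∂κ x = ∫⁻ y, Kernel.rnDeriv κ η x y * g (x, y) ∂η x
  conv_lhs => rw [h1]
  rw [lintegral_withDensity_eq_lintegral_mul _ (Kernel.measurable_rnDeriv_right κ η x) hgx]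
  rfl

/-- The density of the joint laws is the kernel density, available for arbitrary `β` because `α` is
countable. If absolute continuity fails on a set of positive measure, both sides are infinite. -/
theorem klDiv_compProd_right_eq_lintegral [Countable α] [MeasurableSingletonClass α]
    (μ : Measure α) [IsFiniteMeasure μ] (κ η : Kernel α β) [IsMarkovKernel κ]
    [IsMarkovKernel η] :
    klDiv (μ ⊗ₘ κ) (μ ⊗ₘ η) = ∫⁻ x, klDiv (κ x) (η x) ∂μ := by
  by_cases h : ∀ᵐ x ∂μ, κ x ≪ η x
  · have hac : μ ⊗ₘ κ ≪ μ ⊗ₘ η := Measure.absolutelyContinuous_compProd_right_iff.2 h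
    rw [klDiv_eq_lintegral_klFun_of_ac hac]
    have hm : Measurable (Function.uncurry (Kernel.rnDeriv κ η)) := Kernel.measurable_rnDeriv κ η
    have h1 : (μ ⊗ₘ κ).rnDeriv (μ ⊗ₘ η) =ᵐ[μ ⊗ₘ η] Function.uncurry (Kernel.rnDeriv κ η) := by
      conv_lhs => rw [compProd_eq_withDensity_rnDeriv h]
      exact Measure.rnDeriv_withDensity _ hm
    rw [lintegral_congr_ae (h1.mono fun x hx => by rw [hx]),
      Measure.lintegral_compProd
        (f := fun w => ENNReal.ofReal (klFun (Function.uncurry (κ.rnDeriv η) w).toReal))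
        (measurable_klFun.comp hm.ennreal_toReal).ennreal_ofReal]
    refine lintegral_congr_ae (h.mono fun x hx => ?_)
    dsimp only
    rw [klDiv_eq_lintegral_klFun_of_ac hx]
    refine lintegral_congr_ae ?_
    filter_upwards [Kernel.rnDeriv_eq_rnDeriv_measure (κ := κ) (η := η) (a := x)] with y hy
    simp [Function.uncurry, hy]
  · rw [klDiv_of_not_ac (fun h' => h (Measure.absolutelyContinuous_compProd_right_iff.1 h'))]
    symm
    refine lintegral_eq_top_of_measure_eq_top_ne_zero
      (measurable_of_countable fun x => klDiv (κ x) (η x)).aemeasurable ?_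
    intro h0
    refine h ?_
    rw [ae_iff]
    refine measure_mono_null (fun x hx => ?_) h0
    exact klDiv_of_not_ac hx

theorem klDiv_compProd_prod_eq_lintegral [Countable α] [MeasurableSingletonClass α]
    (μ : Measure α) [IsFiniteMeasure μ] (κ : Kernel α β) [IsMarkovKernel κ]
    (q : Measure β) [IsProbabilityMeasure q] :
    klDiv (μ ⊗ₘ κ) (μ.prod q) = ∫⁻ x, klDiv (κ x) q ∂μ := by
  rw [← Measure.compProd_const, klDiv_compProd_right_eq_lintegral]
  rfl

/-- Among all product laws `μ.prod q`, the one with the true output law is closest to the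
joint law. -/
theorem klDiv_compProd_prod_comp_le [StandardBorelSpace α] [Nonempty α]
    (μ : Measure α) [IsProbabilityMeasure μ] (κ : Kernel α β) [IsMarkovKernel κ]
    (q : Measure β) [IsProbabilityMeasure q] :
    klDiv (μ ⊗ₘ κ) (μ.prod (κ ∘ₘ μ)) ≤ klDiv (μ ⊗ₘ κ) (μ.prod q) := by
  set J := (μ ⊗ₘ κ).map Prod.swap with hJ
  have hJp : IsProbabilityMeasure J := Measure.isProbabilityMeasure_map (by fun_prop)
  have hfst : J.fst = κ ∘ₘ μ := by
    rw [hJ, Measure.fst_map_swap, Measure.snd_compProd]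
  -- Disintegrating the joint law over the output confines the dependence on `ν` to `klDiv (κ ∘ₘ μ)
  -- ν`, which vanishes at the true output law.
  have key : ∀ ν : Measure β, IsProbabilityMeasure ν →
      klDiv (μ ⊗ₘ κ) (μ.prod ν) = klDiv (κ ∘ₘ μ) ν +
        klDiv ((κ ∘ₘ μ) ⊗ₘ J.condKernel) ((κ ∘ₘ μ).prod μ) := by
    intro ν hν
    rw [← klDiv_map_swap]
    simp only [Measure.prod_swap]
    rw [← hJ]
    conv_lhs => rw [← J.disintegrate J.condKernel, ← Measure.compProd_const,
      klDiv_compProd_eq_add, hfst, Measure.compProd_const]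
  rw [key _ inferInstance, key q inferInstance, klDiv_self, zero_add]
  exact le_add_self

/-- The density of `a` is at most `f`, hence so are the logarithms. The condition `1 ≤ f` keeps `log
f` nonnegative, so that `ENNReal.ofReal` loses nothing. -/
theorem klDiv_le_lintegral_log_of_le_withDensity (a b : Measure α) [IsProbabilityMeasure a]
    [IsProbabilityMeasure b] {f : α → ℝ≥0∞} (hf : Measurable f) (hf1 : ∀ᵐ x ∂b, 1 ≤ f x)
    (hft : ∀ᵐ x ∂b, f x ≠ ∞) (hab : a ≤ b.withDensity f) :
    klDiv a b ≤ ∫⁻ x, ENNReal.ofReal (Real.log (f x).toReal) ∂a := by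
  have hac : a ≪ b := (Measure.absolutelyContinuous_of_le hab).trans
    (withDensity_absolutelyContinuous _ _)
  have hr : ∀ᵐ x ∂b, a.rnDeriv b x ≤ f x := by
    refine ae_le_of_forall_setLIntegral_le_of_sigmaFinite (Measure.measurable_rnDeriv a b) ?_
    intro s hs _
    rw [Measure.setLIntegral_rnDeriv hac, ← withDensity_apply _ hs]
    exact hab s
  have hlog : Measurable fun x => Real.log (f x).toReal :=
    Real.measurable_log.comp hf.ennreal_toReal
  by_cases htop : ∫⁻ x, ENNReal.ofReal (Real.log (f x).toReal) ∂a = ∞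
  · rw [htop]; exact le_top
  have hnn : ∀ᵐ x ∂b, 0 ≤ Real.log (f x).toReal := by
    filter_upwards [hf1, hft] with x h1 h2
    refine Real.log_nonneg ?_
    rw [← ENNReal.toReal_one]
    exact ENNReal.toReal_mono h2 h1
  have hfint : Integrable (fun x => Real.log (f x).toReal) a := by
    refine ⟨hlog.aestronglyMeasurable, ?_⟩
    rw [hasFiniteIntegral_iff_ofReal (hac.ae_le hnn)]
    exact lt_top_iff_ne_top.2 htop
  have hlog_le : ∀ᵐ x ∂a, Real.log (a.rnDeriv b x).toReal ≤ Real.log (f x).toReal := by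
    filter_upwards [hac.ae_le hr, hac.ae_le hft, Measure.rnDeriv_pos hac,
      hac.ae_le (Measure.rnDeriv_ne_top a b)] with x h1 h2 h3 h4
    exact Real.log_le_log (ENNReal.toReal_pos h3.ne' h4) (ENNReal.toReal_mono h2 h1)
  -- With `r` the density, `klFun r = r log r + 1 - r ≤ r log f + 1`, which is integrable under `b`.
  have hint : Integrable (llr a b) a := by
    rw [← integrable_klFun_rnDeriv_iff hac]
    have hg : Integrable (fun x => (a.rnDeriv b x).toReal * Real.log (f x).toReal + 1) b := by
      refine Integrable.add ?_ (integrable_const 1)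
      exact (integrable_toReal_rnDeriv_mul_iff hac).2 hfint
    refine hg.mono' (measurable_klFun.comp
      (Measure.measurable_rnDeriv a b).ennreal_toReal).aestronglyMeasurable ?_
    filter_upwards [hr, hft, hnn] with x h1 h2 h3
    have h0 : 0 ≤ (a.rnDeriv b x).toReal := ENNReal.toReal_nonneg
    rw [Real.norm_of_nonneg (klFun_nonneg h0), klFun_apply]
    rcases h0.eq_or_lt with h | h
    · rw [← h]; simp
    · have := Real.log_le_log h (ENNReal.toReal_mono h2 h1)
      nlinarith
  rw [klDiv_of_ac_of_integrable hac hint, ← ofReal_integral_eq_lintegral_ofReal hfint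
    (hac.ae_le hnn)]
  refine ENNReal.ofReal_le_ofReal ?_
  simp only [probReal_univ, add_sub_cancel_right]
  exact integral_mono_ae hint hfint hlog_le

/-- Relative entropy of a discrete conditional law is at most the expected self-information. -/
theorem klDiv_compProd_right_le_lintegral_neg_log [Countable β] [MeasurableSingletonClass β]
    (ρ : Measure α) [IsProbabilityMeasure ρ] (K R : Kernel α β) [IsMarkovKernel K]
    [IsMarkovKernel R] (hpos : ∀ᵐ w ∂(ρ ⊗ₘ K), R w.1 {w.2} ≠ 0) :
    klDiv (ρ ⊗ₘ K) (ρ ⊗ₘ R) ≤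
      ∫⁻ w, ENNReal.ofReal (-Real.log (R w.1 {w.2}).toReal) ∂(ρ ⊗ₘ K) := by
  have hm : Measurable fun w : α × β => R w.1 {w.2} :=
    measurable_from_prod_countable_left fun y => R.measurable_coe (measurableSet_singleton y)
  have hm' : Measurable fun w : α × β => (R w.1 {w.2})⁻¹ := hm.inv
  have hR : ∀ᵐ w ∂(ρ ⊗ₘ R), R w.1 {w.2} ≠ 0 := by
    rw [Measure.ae_compProd_iff (p := fun w : α × β => R w.1 {w.2} ≠ 0)
      ((measurableSet_singleton 0).compl.preimage hm)]
    refine Eventually.of_forall fun x => ?_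
    rw [ae_iff]
    refine (measure_null_iff_singleton (Set.to_countable _)).2 ?_
    intro y hy
    simpa using hy
  -- The density of `K` relative to `R` at an atom `y` is `K{y} / R{y} ≤ 1 / R{y}`, so `1 / R{y}`
  -- serves as `f`.
  have h := klDiv_le_lintegral_log_of_le_withDensity (ρ ⊗ₘ K) (ρ ⊗ₘ R) hm'
    (Eventually.of_forall fun w => ENNReal.one_le_inv.2 prob_le_one)
    (hR.mono fun w hw => ENNReal.inv_ne_top.2 hw) ?_
  · refine h.trans (le_of_eq (lintegral_congr fun w => ?_))
    rw [ENNReal.toReal_inv, Real.log_inv]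
  · refine Measure.le_iff.2 fun s hs => ?_
    rw [withDensity_apply _ hs, ← lintegral_indicator hs, Measure.lintegral_compProd
      (hm'.indicator hs)]
    have h1 : (ρ ⊗ₘ K) s = (ρ ⊗ₘ K) (s ∩ {w | R w.1 {w.2} ≠ 0}) :=
      measure_congr (hpos.mono fun w hw => propext ⟨fun h => ⟨h, hw⟩, fun h => h.1⟩)
    have hs' : MeasurableSet (s ∩ {w | R w.1 {w.2} ≠ 0}) :=
      hs.inter ((measurableSet_singleton 0).compl.preimage hm)
    rw [h1, Measure.compProd_apply hs']
    refine lintegral_mono fun x => ?_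
    rw [lintegral_countable', ← lintegral_indicator_one (measurable_prodMk_left hs'),
      lintegral_countable']
    refine ENNReal.tsum_le_tsum fun y => ?_
    by_cases hy : (x, y) ∈ s ∩ {w | R w.1 {w.2} ≠ 0}
    · rw [Set.indicator_of_mem (by exact hy), Set.indicator_of_mem hy.1]
      dsimp only
      rw [ENNReal.inv_mul_cancel hy.2 (measure_ne_top _ _)]
      simpa using prob_le_one
    · rw [Set.indicator_of_notMem (by exact hy)]
      simp

end KullbackLeibler

/-! ### Information lost in a cascade -/

section Cascade

variable {α β γ : Type} [MeasurableSpace α] [MeasurableSpace β] [MeasurableSpace γ]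

theorem lintegral_compProd_prodMkLeft (μ : Measure α) [IsProbabilityMeasure μ]
    (κ : Kernel α β) [IsMarkovKernel κ] (η : Kernel β γ) [IsMarkovKernel η]
    {g : α × β × γ → ℝ≥0∞} (hg : Measurable g) :
    ∫⁻ w, g w ∂(μ ⊗ₘ (κ ⊗ₖ η.prodMkLeft α)) = ∫⁻ x, ∫⁻ y, ∫⁻ z, g (x, y, z) ∂η y ∂κ x ∂μ := by
  rw [Measure.lintegral_compProd hg]
  refine lintegral_congr fun x => ?_
  rw [Kernel.lintegral_compProd _ _ _ (by fun_prop)]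
  rfl

/-- Loss of information in a cascade: passing the discrete output of `κ` through `η` costs at
most the expected self-information of any estimate `R` of the input of `η` from its output. -/
theorem klDiv_le_klDiv_cascade_add [Countable α] [MeasurableSingletonClass α]
    [StandardBorelSpace α] [Nonempty α] [Countable β] [MeasurableSingletonClass β]
    [StandardBorelSpace β] [Nonempty β]
    (μ : Measure α) [IsProbabilityMeasure μ] (κ : Kernel α β) [IsMarkovKernel κ]
    (η : Kernel β γ) [IsMarkovKernel η] (R : Kernel γ β) [IsMarkovKernel R]
    (hpos : ∀ y, ∀ᵐ z ∂η y, R z {y} ≠ 0) :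
    klDiv (μ ⊗ₘ κ) (μ.prod (κ ∘ₘ μ)) ≤
      klDiv (μ ⊗ₘ (η ∘ₖ κ)) (μ.prod ((η ∘ₖ κ) ∘ₘ μ)) +
        ∫⁻ y, ∫⁻ z, ENNReal.ofReal (-Real.log (R z {y}).toReal) ∂η y ∂(κ ∘ₘ μ) := by
  set κ' : Kernel α (β × γ) := κ ⊗ₖ η.prodMkLeft α with hκ'
  have hfst : κ'.fst = κ := by rw [hκ', Kernel.fst_compProd]
  set ν : Measure γ := (η ∘ₖ κ) ∘ₘ μ with hν
  -- Reference law for the pair: `Z` has its true law and `Y` is guessed from `Z` by `R`.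
  set q : Measure (β × γ) := (ν ⊗ₘ R).map Prod.swap with hq
  have hqp : IsProbabilityMeasure q := Measure.isProbabilityMeasure_map (by fun_prop)
  have h1 : klDiv (μ ⊗ₘ κ) (μ.prod (κ ∘ₘ μ)) ≤ klDiv (μ ⊗ₘ κ') (μ.prod (κ' ∘ₘ μ)) := by
    rw [klDiv_compProd_prod_eq_lintegral, klDiv_compProd_prod_eq_lintegral]
    refine lintegral_mono fun x => ?_
    have e1 : κ x = (κ' x).map Prod.fst := by rw [← Kernel.fst_apply, hfst]
    have e2 : κ ∘ₘ μ = (κ' ∘ₘ μ).map Prod.fst := by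
      rw [Measure.map_comp _ _ measurable_fst, ← Kernel.fst_eq, hfst]
    rw [e1, e2]
    exact klDiv_map_le _ _ measurable_fst
  have h2 := klDiv_compProd_prod_comp_le μ κ' q
  -- Reordering to `((x, z), y)` lets the chain rule split off the pair `(X, Z)`, whose term is the
  -- mutual information of the cascade.
  set f : α × β × γ → (α × γ) × β := fun w => ((w.1, w.2.2), w.2.1) with hf
  set g : (α × γ) × β → α × β × γ := fun w => (w.1.1, w.2, w.1.2) with hg
  have hfm : Measurable f := by fun_prop
  have hgm : Measurable g := by fun_prop
  set ρ : Measure ((α × γ) × β) := (μ ⊗ₘ κ').map f with hρ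
  have hρp : IsProbabilityMeasure ρ := Measure.isProbabilityMeasure_map hfm.aemeasurable
  set R' : Kernel (α × γ) β := R.prodMkLeft α with hR'
  have hAg : ρ.map g = μ ⊗ₘ κ' := by
    rw [hρ, Measure.map_map hgm hfm]
    exact Measure.map_id
  have hBg : ((μ.prod ν) ⊗ₘ R').map g = μ.prod q := by
    refine Measure.ext_of_lintegral _ fun u hu => ?_
    rw [lintegral_map hu hgm, Measure.lintegral_compProd (by fun_prop),
      lintegral_prod _ (Measurable.lintegral_kernel_prod_right (κ := R')
        (f := fun a b => u (g (a, b))) (hu.comp hgm)).aemeasurable,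
      lintegral_prod _ hu.aemeasurable]
    refine lintegral_congr fun x => ?_
    rw [hq, lintegral_map (by fun_prop) measurable_swap,
      Measure.lintegral_compProd (by fun_prop)]
    rfl
  have h3 : klDiv (μ ⊗ₘ κ') (μ.prod q) ≤ klDiv ρ ((μ.prod ν) ⊗ₘ R') := by
    rw [← hAg, ← hBg]
    exact klDiv_map_le _ _ hgm
  have hρ1 : ρ.fst = μ ⊗ₘ (η ∘ₖ κ) := by
    refine Measure.ext_of_lintegral _ fun u hu => ?_
    rw [Measure.fst, lintegral_map hu measurable_fst, hρ,
      lintegral_map (by fun_prop) hfm, hκ',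
      lintegral_compProd_prodMkLeft _ _ _ (by fun_prop),
      Measure.lintegral_compProd hu]
    refine lintegral_congr fun x => ?_
    rw [Kernel.lintegral_comp _ _ _ (by fun_prop)]
  have hdis : ρ.fst ⊗ₘ ρ.condKernel = ρ := ρ.disintegrate ρ.condKernel
  have hm : Measurable fun w : (α × γ) × β => R' w.1 {w.2} :=
    measurable_from_prod_countable_left fun y => R'.measurable_coe (measurableSet_singleton y)
  have h4 : klDiv ρ ((μ.prod ν) ⊗ₘ R') = klDiv (μ ⊗ₘ (η ∘ₖ κ)) (μ.prod ν) +
      klDiv (ρ.fst ⊗ₘ ρ.condKernel) (ρ.fst ⊗ₘ R') := by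
    conv_lhs => rw [← hdis]
    rw [klDiv_compProd_eq_add, hρ1]
  have hposρ : ∀ᵐ w ∂(ρ.fst ⊗ₘ ρ.condKernel), R' w.1 {w.2} ≠ 0 := by
    rw [hdis, hρ, ae_map_iff (p := fun w => R' w.1 {w.2} ≠ 0) hfm.aemeasurable
      ((measurableSet_singleton 0).compl.preimage hm),
      hκ']
    rw [Measure.ae_compProd_iff
      (p := fun w => R' (f w).1 {(f w).2} ≠ 0)
      (((measurableSet_singleton 0).compl.preimage hm).preimage hfm)]
    refine Eventually.of_forall fun x => ?_
    rw [Kernel.ae_compProd_iff (p := fun w => R' (f (x, w)).1 {(f (x, w)).2} ≠ 0)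
      ((((measurableSet_singleton 0).compl.preimage hm).preimage hfm).preimage
        measurable_prodMk_left)]
    exact Eventually.of_forall fun y => hpos y
  have h5 := klDiv_compProd_right_le_lintegral_neg_log ρ.fst ρ.condKernel R' hposρ
  have hlm : Measurable fun w : (α × γ) × β =>
      ENNReal.ofReal (-Real.log (R' w.1 {w.2}).toReal) :=
    (Real.measurable_log.comp hm.ennreal_toReal).neg.ennreal_ofReal
  have h6 : ∫⁻ w, ENNReal.ofReal (-Real.log (R' w.1 {w.2}).toReal) ∂ρ =
      ∫⁻ y, ∫⁻ z, ENNReal.ofReal (-Real.log (R z {y}).toReal) ∂η y ∂(κ ∘ₘ μ) := by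
    rw [hρ, lintegral_map hlm hfm, hκ', lintegral_compProd_prodMkLeft _ _ _
        (g := fun w => ENNReal.ofReal (-Real.log (R' (f w).1 {(f w).2}).toReal)) (hlm.comp hfm),
      Measure.lintegral_bind κ.aemeasurable (measurable_of_countable _).aemeasurable]
    rfl
  calc klDiv (μ ⊗ₘ κ) (μ.prod (κ ∘ₘ μ)) ≤ klDiv ρ ((μ.prod ν) ⊗ₘ R') :=
        h1.trans (h2.trans h3)
    _ ≤ _ := by
        rw [h4, ← h6]
        refine add_le_add le_rfl (h5.trans (le_of_eq ?_))
        rw [hdis]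

end Cascade

/-! ### Finiteness, subadditivity and existence of capacity -/

section Capacity

variable {α β γ : Type} [MeasurableSpace α] [MeasurableSpace β] [MeasurableSpace γ]

/-- The law `κ x` enters the uniform mixture with weight `1 / card α`, so its density is at most
`card α`. -/
theorem klDiv_comp_uniform_le [Fintype α] [Nonempty α] [MeasurableSingletonClass α]
    (κ : Kernel α β) [IsMarkovKernel κ] (x : α) :
    klDiv (κ x) (κ ∘ₘ (PMF.uniformOfFintype α).toMeasure) ≤
      ENNReal.ofReal (Real.log (Fintype.card α)) := by
  have hc : (Fintype.card α : ℝ≥0∞) ≠ 0 := by simp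
  have hct : (Fintype.card α : ℝ≥0∞) ≠ ∞ := ENNReal.natCast_ne_top _
  have h := klDiv_le_lintegral_log_of_le_withDensity (κ x)
    (κ ∘ₘ (PMF.uniformOfFintype α).toMeasure) (f := fun _ => (Fintype.card α : ℝ≥0∞))
    measurable_const (Eventually.of_forall fun _ => by
      exact_mod_cast Nat.one_le_iff_ne_zero.2 Fintype.card_ne_zero)
    (Eventually.of_forall fun _ => hct) ?_
  · simpa using h
  · refine Measure.le_iff.2 fun s hs => ?_
    rw [withDensity_const, Measure.smul_apply, Measure.comp_eq_sum_of_countable,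
      Measure.sum_apply _ hs, smul_eq_mul]
    refine le_trans ?_ (mul_le_mul_right (ENNReal.le_tsum x) _)
    rw [Measure.smul_apply, smul_eq_mul, PMF.toMeasure_apply_singleton _ _
      (measurableSet_singleton x), PMF.uniformOfFintype_apply, ← mul_assoc,
      ENNReal.mul_inv_cancel hc hct, one_mul]

theorem mutualInfo_le_of_fintype [Fintype α] [Nonempty α] [MeasurableSingletonClass α]
    (μ : Measure α) [IsProbabilityMeasure μ] (κ : Kernel α β) [IsMarkovKernel κ] :
    mutualInfo μ κ ≤ ENNReal.ofReal (Real.log (Fintype.card α)) /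
      ENNReal.ofReal (Real.log 2) := by
  refine ENNReal.div_le_div_right ?_ _
  refine (klDiv_compProd_prod_comp_le μ κ
    (κ ∘ₘ (PMF.uniformOfFintype α).toMeasure)).trans ?_
  rw [klDiv_compProd_prod_eq_lintegral]
  refine (lintegral_mono fun x => klDiv_comp_uniform_le κ x).trans ?_
  simp

theorem ofReal_log_two_ne_zero : ENNReal.ofReal (Real.log 2) ≠ 0 := by
  rw [Ne, ENNReal.ofReal_eq_zero, not_le]
  exact Real.log_pos one_lt_two

theorem blockCapacity_ne_top (W : ∀ n : ℕ, Kernel (Fin n → Bool) β)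
    [∀ n, IsMarkovKernel (W n)] (n : ℕ) : blockCapacity W n ≠ ∞ := by
  refine ne_top_of_le_ne_top ?_ (iSup_le fun P => mutualInfo_le_of_fintype P.toMeasure (W n))
  exact (ENNReal.div_lt_top ENNReal.ofReal_ne_top ofReal_log_two_ne_zero).ne

theorem lintegral_toMeasure_map {α β : Type} [MeasurableSpace α] [MeasurableSpace β]
    [Countable α] [Countable β] [MeasurableSingletonClass α] [MeasurableSingletonClass β]
    (p : PMF α) (g : α → β) (f : β → ℝ≥0∞) :
    ∫⁻ y, f y ∂(p.map g).toMeasure = ∫⁻ x, f (g x) ∂p.toMeasure := by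
  rw [← PMF.toMeasure_map _ p (measurable_of_countable g),
    lintegral_map (measurable_of_countable f) (measurable_of_countable g)]

/-- The channels `W n` act independently on the two parts of a block, and the outputs are then
merged by `c`. -/
def IsMemoryless (W : ∀ n : ℕ, Kernel (Fin n → Bool) β) (c : β × β → β) : Prop :=
  ∀ (n m : ℕ) (x : Fin n → Bool) (y : Fin m → Bool),
    W (n + m) (Fin.append x y) = ((W n x).prod (W m y)).map c

/-- Merging the two output marginals as if independent gives a reference law, which can only
increase the divergence even when the two input parts are correlated. Data processing through `c`
and additivity over products do the rest. -/
theorem blockCapacity_add_le (W : ∀ n : ℕ, Kernel (Fin n → Bool) β)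
    [∀ n, IsMarkovKernel (W n)] {c : β × β → β} (hc : Measurable c) (hW : IsMemoryless W c)
    (n m : ℕ) : blockCapacity W (n + m) ≤ blockCapacity W n + blockCapacity W m := by
  refine iSup_le fun P => ?_
  set f₁ : (Fin (n + m) → Bool) → (Fin n → Bool) := fun x i => x (Fin.castAdd m i)
  set f₂ : (Fin (n + m) → Bool) → (Fin m → Bool) := fun x i => x (Fin.natAdd n i)
  set P₁ := P.map f₁
  set P₂ := P.map f₂
  set q₁ := W n ∘ₘ P₁.toMeasure
  set q₂ := W m ∘ₘ P₂.toMeasure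
  have hq : IsProbabilityMeasure ((q₁.prod q₂).map c) :=
    Measure.isProbabilityMeasure_map hc.aemeasurable
  refine le_trans ?_ (add_le_add (le_iSup (fun P : PMF (Fin n → Bool) =>
    mutualInfo P.toMeasure (W n)) P₁) (le_iSup (fun P : PMF (Fin m → Bool) =>
    mutualInfo P.toMeasure (W m)) P₂))
  simp only [mutualInfo]
  rw [ENNReal.div_add_div_same]
  refine ENNReal.div_le_div_right ?_ _
  refine (klDiv_compProd_prod_comp_le P.toMeasure (W (n + m)) ((q₁.prod q₂).map c)).trans ?_
  have e₁ : ∫⁻ x, klDiv (W n x) q₁ ∂P₁.toMeasure = ∫⁻ x, klDiv (W n (f₁ x)) q₁ ∂P.toMeasure :=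
    lintegral_toMeasure_map P f₁ _
  have e₂ : ∫⁻ x, klDiv (W m x) q₂ ∂P₂.toMeasure = ∫⁻ x, klDiv (W m (f₂ x)) q₂ ∂P.toMeasure :=
    lintegral_toMeasure_map P f₂ _
  rw [klDiv_compProd_prod_eq_lintegral, klDiv_compProd_prod_eq_lintegral,
    klDiv_compProd_prod_eq_lintegral, e₁, e₂, ← lintegral_add_left (measurable_of_countable _)]
  refine lintegral_mono fun x => ?_
  have hx : x = Fin.append (f₁ x) (f₂ x) := (Fin.append_castAdd_natAdd (f := x)).symm
  have h := hW n m (f₁ x) (f₂ x)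
  rw [← hx] at h
  rw [h, ← klDiv_prod]
  exact klDiv_map_le _ _ hc

theorem exists_hasCapacity (W : ∀ n : ℕ, Kernel (Fin n → Bool) β)
    [∀ n, IsMarkovKernel (W n)] {c : β × β → β} (hc : Measurable c) (hW : IsMemoryless W c) :
    ∃ C : ℝ≥0, HasCapacity W C := by
  have hsub : Subadditive fun n => (blockCapacity W n).toReal := fun n m => by
    rw [← ENNReal.toReal_add (blockCapacity_ne_top W n) (blockCapacity_ne_top W m)]
    exact ENNReal.toReal_mono (ENNReal.add_ne_top.2
      ⟨blockCapacity_ne_top W n, blockCapacity_ne_top W m⟩) (blockCapacity_add_le W hc hW n m)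
  have hnn : ∀ n : ℕ, 0 ≤ (blockCapacity W n).toReal / n := fun n =>
    div_nonneg ENNReal.toReal_nonneg n.cast_nonneg
  have hbdd : BddBelow (Set.range fun n : ℕ => (blockCapacity W n).toReal / n) :=
    ⟨0, by rintro _ ⟨n, rfl⟩; exact hnn n⟩
  have ht := hsub.tendsto_lim hbdd
  refine ⟨hsub.lim.toNNReal, ?_⟩
  have h := ENNReal.tendsto_ofReal ht
  refine h.congr' ?_
  filter_upwards [eventually_gt_atTop 0] with n hn
  rw [ENNReal.ofReal_div_of_pos (by exact_mod_cast hn),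
    ENNReal.ofReal_toReal (blockCapacity_ne_top W n), ENNReal.ofReal_natCast]

end Capacity

/-! ### Concatenation and measurability of strings -/

section Word

theorem Word.ext {α : Type} {s t : Word α} (h : s.1 = t.1)
    (h' : ∀ i, s.2 i = t.2 (Fin.cast h i)) : s = t := by
  obtain ⟨m, s⟩ := s
  obtain ⟨k, t⟩ := t
  obtain rfl : m = k := h
  congr
  exact funext h'

theorem Word.nil_append {α : Type} (s : Word α) : Word.nil.append s = s :=
  Word.ext (Nat.zero_add _) fun i => congrFun (Fin.elim0_append s.2) i

theorem Word.append_assoc {α : Type} (s t u : Word α) :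
    (s.append t).append u = s.append (t.append u) :=
  Word.ext (Nat.add_assoc _ _ _) fun i => congrFun (Fin.append_assoc s.2 t.2 u.2) i

theorem measurableEmbedding_wordMk {α : Type} [MeasurableSpace α] (m : ℕ) :
    MeasurableEmbedding (fun z : Fin m → α => (⟨m, z⟩ : Word α)) where
  injective := sigma_mk_injective (β := fun m => Fin m → α)
  measurable := measurable_wordMk m
  measurableSet_image' := by
    intro s hs
    refine MeasurableSpace.measurableSet_iInf.2 fun k => ?_
    change MeasurableSet ((fun z : Fin k → α => (⟨k, z⟩ : Word α)) ⁻¹' _)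
    by_cases h : k = m
    · subst h
      rwa [Set.preimage_image_eq _ (sigma_mk_injective (β := fun m => Fin m → α))]
    · convert MeasurableSet.empty
      ext z
      simp only [Set.mem_preimage, Set.mem_image, Set.mem_empty_iff_false, iff_false]
      rintro ⟨y, -, hy⟩
      exact h (congrArg Sigma.fst hy).symm

theorem measurable_of_comp_wordMk {α β : Type} [MeasurableSpace α] [MeasurableSpace β]
    {f : Word α → β} (h : ∀ m, Measurable fun z : Fin m → α => f ⟨m, z⟩) : Measurable f :=
  fun _ hs => MeasurableSpace.measurableSet_iInf.2 fun m => h m hs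

theorem measurable_fin_append {α : Type} [MeasurableSpace α] (m k : ℕ) :
    Measurable fun w : (Fin m → α) × (Fin k → α) => Fin.append w.1 w.2 := by
  refine measurable_pi_lambda _ fun i => ?_
  induction i using Fin.addCases with
  | left i => simpa using (by fun_prop : Measurable fun w : (Fin m → α) × (Fin k → α) => w.1 i)
  | right i => simpa using (by fun_prop : Measurable fun w : (Fin m → α) × (Fin k → α) => w.2 i)

/-- Once both lengths are fixed, concatenation is measurable on a product of finite powers; the
preimage is a countable union of embedded images of such pieces. -/
theorem measurable_wordAppend {α : Type} [MeasurableSpace α] :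
    Measurable fun w : Word α × Word α => w.1.append w.2 := by
  intro s hs
  have he : ∀ m k : ℕ, MeasurableEmbedding (Prod.map
      (fun z : Fin m → α => (⟨m, z⟩ : Word α)) (fun z : Fin k → α => (⟨k, z⟩ : Word α))) :=
    fun m k => (measurableEmbedding_wordMk m).prodMap (measurableEmbedding_wordMk k)
  have hu : (fun w : Word α × Word α => w.1.append w.2) ⁻¹' s = ⋃ m : ℕ, ⋃ k : ℕ,
      Prod.map (fun z : Fin m → α => (⟨m, z⟩ : Word α)) (fun z : Fin k → α => (⟨k, z⟩ : Word α)) ''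
        {v | (⟨m + k, Fin.append v.1 v.2⟩ : Word α) ∈ s} := by
    ext w
    simp only [Set.mem_preimage, Set.mem_iUnion, Set.mem_image]
    constructor
    · intro h
      exact ⟨w.1.1, w.2.1, (w.1.2, w.2.2), h, rfl⟩
    · rintro ⟨m, k, v, hv, rfl⟩
      exact hv
  rw [hu]
  refine MeasurableSet.iUnion fun m => MeasurableSet.iUnion fun k =>
    (he m k).measurableSet_image' ?_
  exact ((measurable_wordMk (m + k)).comp (measurable_fin_append m k)) hs

end Word

/-! ### Both channels are memoryless -/

section Memoryless

theorem lintegral_toMeasure_bind {α β : Type} [MeasurableSpace α] [MeasurableSpace β]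
    [Countable α] [Countable β] [MeasurableSingletonClass α] [MeasurableSingletonClass β]
    (p : PMF α) (g : α → PMF β) (f : β → ℝ≥0∞) :
    ∫⁻ y, f y ∂(p.bind g).toMeasure = ∫⁻ x, ∫⁻ y, f y ∂(g x).toMeasure ∂p.toMeasure := by
  simp only [lintegral_countable', PMF.toMeasure_apply_singleton _ _ (measurableSet_singleton _),
    PMF.bind_apply, ← ENNReal.tsum_mul_left, ← ENNReal.tsum_mul_right]
  rw [ENNReal.tsum_comm]
  refine tsum_congr fun x => tsum_congr fun y => ?_
  ring

theorem syncOutput_append (p : Bool → PMF (Word Bool)) (x y : List Bool) :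
    syncOutput p (x ++ y) =
      (syncOutput p x).bind fun s => (syncOutput p y).map fun t => s.append t := by
  induction x with
  | nil =>
    have h : PMF.map (fun t => t) (syncOutput p y) = syncOutput p y := PMF.map_id _
    simp [syncOutput, Word.nil_append, PMF.pure_bind, h]
  | cons b x ih =>
    simp only [List.cons_append, syncOutput, ih, PMF.map, PMF.bind_bind, PMF.pure_bind,
      Function.comp_def, Word.append_assoc]

theorem isMemoryless_syncChannel (p : Bool → PMF (Word Bool)) :
    IsMemoryless (syncChannel p) fun w => w.1.append w.2 := by
  intro n m x y
  refine Measure.ext_of_lintegral _ fun f hf => ?_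
  rw [lintegral_map hf measurable_wordAppend,
    lintegral_prod _ (measurable_of_countable _).aemeasurable]
  change ∫⁻ w, f w ∂(syncOutput p (List.ofFn (Fin.append x y))).toMeasure = _
  rw [List.ofFn_fin_append, syncOutput_append, lintegral_toMeasure_bind]
  simp only [lintegral_toMeasure_map]
  rfl

theorem map_append_pi {α : Type} [MeasurableSpace α] {m k : ℕ} (ρ : Fin (m + k) → Measure α)
    [∀ i, IsProbabilityMeasure (ρ i)] :
    ((Measure.pi fun i => ρ (Fin.castAdd k i)).prod
      (Measure.pi fun i => ρ (Fin.natAdd m i))).map (fun w => Fin.append w.1 w.2) =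
      Measure.pi ρ := by
  symm
  refine Measure.pi_eq fun s hs => ?_
  rw [Measure.map_apply (measurable_fin_append m k) (MeasurableSet.univ_pi hs)]
  have h : (fun w : (Fin m → α) × (Fin k → α) => Fin.append w.1 w.2) ⁻¹' Set.univ.pi s =
      (Set.univ.pi fun i => s (Fin.castAdd k i)) ×ˢ (Set.univ.pi fun i => s (Fin.natAdd m i)) := by
    ext w
    simp only [Set.mem_preimage, Set.mem_univ_pi, Set.mem_prod]
    constructor
    · intro hw
      exact ⟨fun i => by simpa using hw (Fin.castAdd k i),
        fun i => by simpa using hw (Fin.natAdd m i)⟩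
    · rintro ⟨h1, h2⟩ i
      induction i using Fin.addCases with
      | left i => simpa using h1 i
      | right i => simpa using h2 i
  rw [h, Measure.prod_prod, Measure.pi_pi, Measure.pi_pi, Fin.prod_univ_add]

theorem awgnChannel_append (σ : ℝ) (s t : Word Bool) :
    awgnChannel σ (s.append t) =
      ((awgnChannel σ s).prod (awgnChannel σ t)).map fun w => w.1.append w.2 := by
  change (Measure.pi _).map _ = (((Measure.pi _).map _).prod ((Measure.pi _).map _)).map _
  rw [Measure.map_prod_map _ _ (measurable_wordMk s.1) (measurable_wordMk t.1),
    Measure.map_map measurable_wordAppend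
      ((measurable_wordMk s.1).prodMap (measurable_wordMk t.1))]
  have h := map_append_pi (m := s.1) (k := t.1) fun i =>
    gaussianReal (bpsk (Fin.append s.2 t.2 i)) (Real.toNNReal (σ ^ 2))
  simp only [Fin.append_left, Fin.append_right] at h
  refine (congrArg (Measure.map fun z : Fin (s.1 + t.1) → ℝ => (⟨_, z⟩ : Word ℝ)) h.symm).trans ?_
  exact Measure.map_map (measurable_wordMk (s.1 + t.1)) (measurable_fin_append _ _)

instance (p : Bool → PMF (Word Bool)) (σ : ℝ) (n : ℕ) :
    IsMarkovKernel (awgnSyncChannel p σ n) := by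
  unfold awgnSyncChannel
  infer_instance

theorem isMemoryless_awgnSyncChannel (p : Bool → PMF (Word Bool)) (σ : ℝ) :
    IsMemoryless (awgnSyncChannel p σ) fun w => w.1.append w.2 := by
  intro n m x y
  refine Measure.ext_of_lintegral _ fun f hf => ?_
  have hfc : Measurable fun w : Word ℝ × Word ℝ => f (w.1.append w.2) :=
    hf.comp measurable_wordAppend
  rw [lintegral_map hf measurable_wordAppend, lintegral_prod _ hfc.aemeasurable]
  simp only [awgnSyncChannel]
  rw [Kernel.lintegral_comp _ _ _ hf, isMemoryless_syncChannel p n m x y,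
    lintegral_map (measurable_of_countable _) measurable_wordAppend,
    lintegral_prod _ (measurable_of_countable _).aemeasurable,
    Kernel.lintegral_comp _ _ _ hfc.lintegral_prod_right']
  refine lintegral_congr fun s => ?_
  have h1 : ∀ z : Word ℝ, ∫⁻ w, f (z.append w) ∂(awgnChannel σ ∘ₖ syncChannel p m) y =
      ∫⁻ t, ∫⁻ w, f (z.append w) ∂awgnChannel σ t ∂syncChannel p m y := fun z =>
    Kernel.lintegral_comp _ _ _ (hfc.comp measurable_prodMk_left)
  simp only [h1]
  -- Tonelli exchanges the noise on the first part with the bit string of the second, so that both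
  -- bit strings are fixed before the noise is split.
  rw [lintegral_lintegral_swap]
  · refine lintegral_congr fun t => ?_
    rw [awgnChannel_append, lintegral_map hf measurable_wordAppend,
      lintegral_prod _ hfc.aemeasurable]
  · refine Measurable.aemeasurable ?_
    refine measurable_from_prod_countable_left fun t => ?_
    exact (hfc.lintegral_prod_right' (ν := awgnChannel σ t))

end Memoryless

/-! ### Mean output length -/

section MeanLength

theorem lintegral_length_syncOutput (p : Bool → PMF (Word Bool)) (x : List Bool) :
    ∫⁻ w, (w.1 : ℝ≥0∞) ∂(syncOutput p x).toMeasure =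
      (x.map fun b => meanLength (p b).toMeasure).sum := by
  induction x with
  | nil =>
    simp [syncOutput, PMF.toMeasure_pure, Word.nil]
  | cons b x ih =>
    rw [syncOutput, lintegral_toMeasure_bind]
    simp only [lintegral_toMeasure_map, Word.append, Nat.cast_add]
    simp only [lintegral_add_left (measurable_of_countable _), ih]
    simp [meanLength]

theorem meanLength_syncChannel_comp (p : Bool → PMF (Word Bool)) {n : ℕ}
    (μ : Measure (Fin n → Bool)) :
    meanLength (syncChannel p n ∘ₘ μ) =
      ∫⁻ x, ∑ i, meanLength (p (x i)).toMeasure ∂μ := by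
  rw [meanLength, Measure.lintegral_bind (Kernel.aemeasurable _)
    (measurable_of_countable _).aemeasurable]
  refine lintegral_congr fun x => ?_
  refine (lintegral_length_syncOutput p (List.ofFn x)).trans ?_
  rw [List.map_ofFn, List.sum_ofFn]
  rfl

end MeanLength

end SyncChannel

noncomputable section

namespace SyncChannel

/-! ### The uniform-bit posterior as a guess of the sent string -/

section Posterior

/-- Posterior probability of a uniform bit given the output of the BPSK AWGN channel. -/
def bitPosterior (σ : ℝ) (b : Bool) (t : ℝ) : ℝ :=
  (1 + Real.exp (-(2 * (t * bpsk b)) / σ ^ 2))⁻¹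

theorem bitPosterior_pos (σ : ℝ) (b : Bool) (t : ℝ) : 0 < bitPosterior σ b t := by
  unfold bitPosterior
  positivity

theorem sum_bitPosterior (σ t : ℝ) : ∑ b, bitPosterior σ b t = 1 := by
  have h : Real.exp (-(2 * (t * -1)) / σ ^ 2) = (Real.exp (-(2 * (t * 1)) / σ ^ 2))⁻¹ := by
    rw [← Real.exp_neg]
    congr 1
    ring
  simp only [Fintype.sum_bool, bitPosterior, bpsk, if_true, Bool.false_eq_true, if_false, h]
  have := Real.exp_pos (-(2 * (t * 1)) / σ ^ 2)
  field_simp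
  ring

@[fun_prop]
theorem measurable_bitPosterior (σ : ℝ) (b : Bool) : Measurable (bitPosterior σ b) := by
  unfold bitPosterior
  fun_prop

/-- Posterior probability of a string of independent uniform bits given the noisy string. -/
def wordPosterior (σ : ℝ) (z : Word ℝ) (y : Word Bool) : ℝ≥0∞ :=
  if h : y.1 = z.1 then
    ∏ i : Fin y.1, ENNReal.ofReal (bitPosterior σ (y.2 i) (z.2 (Fin.cast h i)))
  else 0

theorem wordPosterior_mk (σ : ℝ) {m : ℕ} (v : Fin m → ℝ) (y : Fin m → Bool) :
    wordPosterior σ ⟨m, v⟩ ⟨m, y⟩ = ∏ i, ENNReal.ofReal (bitPosterior σ (y i) (v i)) := by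
  simp [wordPosterior]

theorem measurable_wordPosterior (σ : ℝ) : Measurable (Function.uncurry (wordPosterior σ)) := by
  refine measurable_from_prod_countable_left fun y => ?_
  refine measurable_of_comp_wordMk fun m => ?_
  obtain ⟨k, y⟩ := y
  by_cases h : k = m
  · subst h
    simp only [Function.uncurry, wordPosterior_mk]
    fun_prop
  · simp only [Function.uncurry, wordPosterior, h, dif_neg, not_false_eq_true]
    exact measurable_const

theorem tsum_wordPosterior (σ : ℝ) (z : Word ℝ) : ∑' y, wordPosterior σ z y = 1 := by
  obtain ⟨m, v⟩ := z
  rw [ENNReal.tsum_sigma', tsum_eq_single m]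
  · simp only [wordPosterior_mk]
    rw [tsum_fintype, ← Fintype.prod_sum (fun i b => ENNReal.ofReal (bitPosterior σ b (v i)))]
    refine Finset.prod_eq_one fun i _ => ?_
    rw [← ENNReal.ofReal_sum_of_nonneg fun b _ => (bitPosterior_pos σ b _).le, sum_bitPosterior,
      ENNReal.ofReal_one]
  · intro k hk
    simp [wordPosterior, hk]

/-- The estimate of the sent string from the noisy string, as a channel. -/
def posteriorKernel (σ : ℝ) : Kernel (Word ℝ) (Word Bool) :=
  Kernel.withDensity (Kernel.const _ Measure.count) (wordPosterior σ)

theorem posteriorKernel_apply_singleton (σ : ℝ) (z : Word ℝ) (y : Word Bool) :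
    posteriorKernel σ z {y} = wordPosterior σ z y := by
  rw [posteriorKernel, Kernel.withDensity_apply' _ (measurable_wordPosterior σ)]
  simp

instance (σ : ℝ) : IsMarkovKernel (posteriorKernel σ) := ⟨fun z => ⟨by
  rw [posteriorKernel, Kernel.withDensity_apply' _ (measurable_wordPosterior σ)]
  simp [lintegral_count, tsum_wordPosterior]⟩⟩

/-- Expected self-information, in nats, of a bit given its noisy observation. -/
def symbolLoss (σ : ℝ) : ℝ≥0∞ :=
  ∫⁻ x, ENNReal.ofReal (Real.log (1 + Real.exp (-(2 * (1 - σ * x)) / σ ^ 2))) ∂gaussianReal 0 1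

theorem lintegral_neg_log_bitPosterior (σ : ℝ) (b : Bool) :
    ∫⁻ t, ENNReal.ofReal (-Real.log (bitPosterior σ b t))
      ∂gaussianReal (bpsk b) (Real.toNNReal (σ ^ 2)) = symbolLoss σ := by
  have hb : bpsk b * bpsk b = 1 := by cases b <;> simp [bpsk]
  -- Writing the noise as `-(bpsk b * σ) * x` with `x` standard normal makes `t * bpsk b = 1 - σ *
  -- x`, which no longer depends on the bit.
  have hmap : (gaussianReal 0 1).map (fun x => bpsk b + -(bpsk b * σ) * x) =
      gaussianReal (bpsk b) (Real.toNNReal (σ ^ 2)) := by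
    have h1 := gaussianReal_map_const_mul (μ := 0) (v := 1) (-(bpsk b * σ))
    have h2 := gaussianReal_map_const_add (μ := 0) (v := Real.toNNReal (σ ^ 2)) (bpsk b)
    have hv : NNReal.mk ((-(bpsk b * σ)) ^ 2) (sq_nonneg _) * 1 = Real.toNNReal (σ ^ 2) := by
      rw [mul_one, ← NNReal.coe_inj, Real.coe_toNNReal _ (sq_nonneg σ), NNReal.coe_mk]
      linear_combination σ ^ 2 * hb
    rw [hv, mul_zero] at h1
    rw [zero_add, ← h1, Measure.map_map (by fun_prop) (by fun_prop)] at h2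
    exact h2
  rw [← hmap, lintegral_map (by fun_prop) (by fun_prop)]
  refine lintegral_congr fun x => ?_
  have e : (bpsk b + -(bpsk b * σ) * x) * bpsk b = 1 - σ * x := by
    linear_combination (1 - σ * x) * hb
  rw [bitPosterior, Real.log_inv, neg_neg, e]

/-- A product posterior has additive self-information, and each symbol costs the same. Only the
length of `y` survives, which is how `E{M}` enters. -/
theorem lintegral_neg_log_posteriorKernel (σ : ℝ) (y : Word Bool) :
    ∫⁻ z, ENNReal.ofReal (-Real.log (posteriorKernel σ z {y}).toReal) ∂awgnChannel σ y =
      y.1 * symbolLoss σ := by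
  obtain ⟨m, y⟩ := y
  change ∫⁻ z, _ ∂(Measure.pi fun i : Fin m => gaussianReal (bpsk (y i))
    (Real.toNNReal (σ ^ 2))).map (fun v => (⟨m, v⟩ : Word ℝ)) = _
  have hm : Measurable fun z : Word ℝ => posteriorKernel σ z {⟨m, y⟩} :=
    Kernel.measurable_coe _ (measurableSet_singleton _)
  rw [lintegral_map (by fun_prop) (measurable_wordMk m)]
  have h : ∀ v : Fin m → ℝ,
      ENNReal.ofReal (-Real.log (posteriorKernel σ ⟨m, v⟩ {⟨m, y⟩}).toReal) =
        ∑ i, ENNReal.ofReal (-Real.log (bitPosterior σ (y i) (v i))) := by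
    intro v
    rw [posteriorKernel_apply_singleton, wordPosterior_mk, ENNReal.toReal_prod]
    simp only [ENNReal.toReal_ofReal (bitPosterior_pos σ _ _).le]
    rw [Real.log_prod fun i _ => (bitPosterior_pos σ _ _).ne', ← Finset.sum_neg_distrib,
      ENNReal.ofReal_sum_of_nonneg]
    intro i _
    rw [bitPosterior, Real.log_inv, neg_neg]
    exact Real.log_nonneg (by linarith [Real.exp_pos (-(2 * (v i * bpsk (y i))) / σ ^ 2)])
  simp only [h]
  rw [lintegral_finsetSum _ (fun i _ => by fun_prop)]
  have hi : ∀ i : Fin m, ∫⁻ v : Fin m → ℝ, ENNReal.ofReal (-Real.log (bitPosterior σ (y i) (v i)))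
      ∂(Measure.pi fun i => gaussianReal (bpsk (y i)) (Real.toNNReal (σ ^ 2))) =
      symbolLoss σ := fun i => by
    rw [← lintegral_neg_log_bitPosterior σ (y i)]
    exact (measurePreserving_eval (fun i => gaussianReal (bpsk (y i)) (Real.toNNReal (σ ^ 2)))
      i).lintegral_comp (f := fun t => ENNReal.ofReal (-Real.log (bitPosterior σ (y i) t)))
      (by fun_prop)
  simp [hi]

theorem ae_posteriorKernel_ne_zero (σ : ℝ) (y : Word Bool) :
    ∀ᵐ z ∂awgnChannel σ y, posteriorKernel σ z {y} ≠ 0 := by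
  obtain ⟨m, y⟩ := y
  have hm : Measurable fun z : Word ℝ => posteriorKernel σ z {⟨m, y⟩} :=
    Kernel.measurable_coe _ (measurableSet_singleton _)
  change ∀ᵐ z ∂(Measure.pi fun i : Fin m => gaussianReal (bpsk (y i))
    (Real.toNNReal (σ ^ 2))).map (fun v => (⟨m, v⟩ : Word ℝ)), _
  rw [ae_map_iff (p := fun z => posteriorKernel σ z {⟨m, y⟩} ≠ 0)
    (measurable_wordMk m).aemeasurable ((measurableSet_singleton 0).compl.preimage hm)]
  refine Eventually.of_forall fun v => ?_
  rw [posteriorKernel_apply_singleton, wordPosterior_mk, Finset.prod_ne_zero_iff]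
  intro i _
  rw [Ne, ENNReal.ofReal_eq_zero, not_le]
  exact bitPosterior_pos _ _ _

theorem mutualInfo_syncChannel_le (p : Bool → PMF (Word Bool)) (σ : ℝ) {n : ℕ}
    (P : PMF (Fin n → Bool)) :
    mutualInfo P.toMeasure (syncChannel p n) ≤
      mutualInfo P.toMeasure (awgnSyncChannel p σ n) +
        meanLength (syncChannel p n ∘ₘ P.toMeasure) *
          (symbolLoss σ / ENNReal.ofReal (Real.log 2)) := by
  have : Nonempty (Word Bool) := ⟨Word.nil⟩
  have h := klDiv_le_klDiv_cascade_add P.toMeasure (syncChannel p n) (awgnChannel σ)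
    (posteriorKernel σ) (ae_posteriorKernel_ne_zero σ)
  simp only [lintegral_neg_log_posteriorKernel] at h
  rw [lintegral_mul_const _ (measurable_of_countable _)] at h
  simp only [mutualInfo]
  rw [← mul_div_assoc, ENNReal.div_add_div_same]
  exact ENNReal.div_le_div_right h _

end Posterior

/-! ### Gaussian tilting, tails and truncated means -/

section Gaussian

theorem setIntegral_gaussianReal (f : ℝ → ℝ) {S : Set ℝ} (hS : MeasurableSet S) :
    ∫ x in S, f x ∂gaussianReal 0 1 = ∫ x in S, gaussianPDFReal 0 1 x * f x := by
  rw [← integral_indicator hS, ← integral_indicator hS,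
    integral_gaussianReal_eq_integral_smul one_ne_zero]
  refine integral_congr_ae (Eventually.of_forall fun x => ?_)
  by_cases hx : x ∈ S <;> simp [hx]

/-- Completing the square: an exponential tilt shifts the mean to `c`. -/
theorem setIntegral_exp_mul_gaussianReal (c : ℝ) {S : Set ℝ} (hS : MeasurableSet S) :
    ∫ x in S, Real.exp (c * x) ∂gaussianReal 0 1 =
      Real.exp (c ^ 2 / 2) * (gaussianReal c 1).real S := by
  rw [setIntegral_gaussianReal _ hS, measureReal_def,
    gaussianReal_apply_eq_integral c one_ne_zero, ENNReal.toReal_ofReal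
    (integral_nonneg fun x => gaussianPDFReal_nonneg c 1 x), ← integral_const_mul]
  refine integral_congr_ae (Eventually.of_forall fun x => ?_)
  simp only [gaussianPDFReal, NNReal.coe_one, mul_one]
  rw [mul_assoc, ← Real.exp_add, mul_left_comm, ← Real.exp_add]
  congr 2
  ring

theorem gaussianReal_real_Ioi (c a : ℝ) : (gaussianReal c 1).real (Set.Ioi a) = Q (a - c) := by
  have h := gaussianReal_map_const_add (μ := 0) (v := 1) c
  rw [zero_add] at h
  rw [← h, map_measureReal_apply (by fun_prop) measurableSet_Ioi, Q]
  congr 1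
  ext x
  simp only [Set.mem_preimage, Set.mem_Ioi]
  constructor <;> intro h <;> linarith

theorem gaussianReal_real_Iic (c a : ℝ) : (gaussianReal c 1).real (Set.Iic a) = Q (c - a) := by
  have h := gaussianReal_map_const_sub (μ := 0) (v := 1) c
  rw [sub_zero] at h
  have hn : NullSingletonClass (gaussianReal 0 1) := nullSingletonClass_gaussianReal one_ne_zero
  rw [← h, map_measureReal_apply (by fun_prop) measurableSet_Iic, Q,
    measureReal_congr (Ioi_ae_eq_Ici (μ := gaussianReal 0 1) (a := c - a))]
  congr 1
  ext x
  simp only [Set.mem_preimage, Set.mem_Iic, Set.mem_Ici]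
  constructor <;> intro h <;> linarith

theorem Q_nonneg (x : ℝ) : 0 ≤ Q x := measureReal_nonneg

/-- Chernoff bound with the optimal parameter `t = x`. -/
theorem Q_le_exp {x : ℝ} (hx : 0 ≤ x) : Q x ≤ Real.exp (-(x ^ 2 / 2)) := by
  have h := measure_ge_le_exp_mul_mgf (μ := gaussianReal 0 1) (X := id) (t := x) x hx
    (integrable_exp_mul_gaussianReal x)
  rw [mgf_id_gaussianReal] at h
  have hs : Set.Ioi x ⊆ {y | x ≤ id y} := fun y hy => (show x ≤ y from le_of_lt hy)
  refine (measureReal_mono hs).trans (h.trans (le_of_eq ?_))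
  simp only [NNReal.coe_one]
  rw [← Real.exp_add]
  congr 1
  ring

theorem hasDerivAt_gaussianPDFReal (x : ℝ) :
    HasDerivAt (gaussianPDFReal 0 1) (-(gaussianPDFReal 0 1 x * x)) x := by
  have h : HasDerivAt (fun y : ℝ => -(y - 0) ^ 2 / (2 * ((1 : ℝ≥0) : ℝ))) (-x) x := by
    have := (((hasDerivAt_id x).sub_const 0).pow 2).neg.div_const (2 * ((1 : ℝ≥0) : ℝ))
    refine this.congr_deriv ?_
    simp
    ring
  have h2 := (h.exp).const_mul (√(2 * Real.pi * ((1 : ℝ≥0) : ℝ)))⁻¹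
  refine h2.congr_deriv ?_
  simp only [gaussianPDFReal]
  ring

theorem integrable_id_gaussianReal : Integrable (fun x => x) (gaussianReal 0 1) :=
  memLp_one_iff_integrable.1 (memLp_id_gaussianReal 1)

theorem tendsto_gaussianPDFReal_atTop : Tendsto (gaussianPDFReal 0 1) atTop (𝓝 0) := by
  have h : Tendsto (fun x : ℝ => (√(2 * Real.pi * ((1 : ℝ≥0) : ℝ)))⁻¹ *
      Real.exp (-(x - 0) ^ 2 / (2 * ((1 : ℝ≥0) : ℝ)))) atTop
      (𝓝 ((√(2 * Real.pi * ((1 : ℝ≥0) : ℝ)))⁻¹ * 0)) := by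
    refine Tendsto.const_mul _ (Real.tendsto_exp_atBot.comp ?_)
    have h1 : Tendsto (fun x : ℝ => x ^ 2 / 2) atTop atTop :=
      (tendsto_pow_atTop two_ne_zero).atTop_div_const two_pos
    refine (tendsto_neg_atTop_atBot.comp h1).congr fun x => ?_
    simp [neg_div]
  rw [mul_zero] at h
  exact h

theorem setIntegral_Ioi_id_gaussianReal (a : ℝ) :
    ∫ x in Set.Ioi a, x ∂gaussianReal 0 1 = gaussianPDFReal 0 1 a := by
  rw [setIntegral_gaussianReal _ measurableSet_Ioi]
  have hi : Integrable (fun x => gaussianPDFReal 0 1 x * x) volume := by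
    have h := integrable_id_gaussianReal
    rw [gaussianReal_of_var_ne_zero _ one_ne_zero,
      integrable_withDensity_iff (measurable_gaussianPDF _ _)
        (Eventually.of_forall fun _ => gaussianPDF_lt_top)] at h
    refine h.congr (Eventually.of_forall fun x => ?_)
    simp only [toReal_gaussianPDF]
    ring
  have h := integral_Ioi_of_hasDerivAt_of_tendsto' (a := a) (f := fun x => -gaussianPDFReal 0 1 x)
    (f' := fun x => gaussianPDFReal 0 1 x * x) (m := 0)
    (fun x _ => (hasDerivAt_gaussianPDFReal x).neg.congr_deriv (neg_neg _)) hi.integrableOn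
    (by simpa using tendsto_gaussianPDFReal_atTop.neg)
  simpa using h

end Gaussian

/-! ### Bounding the loss per symbol, and its limit -/

section Loss

/-- Expected value of the likelihood ratio of the less likely to the more likely bit. -/
def errorRatio (σ : ℝ) : ℝ := Q (1 / σ) + Real.exp (4 / σ ^ 2) * Q (3 / σ)

theorem errorRatio_nonneg (σ : ℝ) : 0 ≤ errorRatio σ :=
  add_nonneg (Q_nonneg _) (mul_nonneg (Real.exp_pos _).le (Q_nonneg _))

theorem log_two_mul_awgnLoss (σ : ℝ) : Real.log 2 * awgnLoss σ =
    (2 / (√(2 * Real.pi) * σ) * Real.exp (-(1 / (2 * σ ^ 2))) - 2 / σ ^ 2 * Q (1 / σ)) +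
      Real.log (1 + errorRatio σ) := by
  have h2 : Real.log 2 ≠ 0 := (Real.log_pos one_lt_two).ne'
  rw [awgnLoss, errorRatio, Real.logb, Real.logb, Real.log_exp, ← add_assoc]
  field_simp

theorem integrable_exp_affine_gaussianReal (a b : ℝ) :
    Integrable (fun x => Real.exp (a + b * x)) (gaussianReal 0 1) := by
  simp only [Real.exp_add]
  exact (integrable_exp_mul_gaussianReal b).const_mul _

theorem setIntegral_Iic_exp {σ : ℝ} (hσ : 0 < σ) :
    ∫ x in Set.Iic (1 / σ), Real.exp (-(2 / σ ^ 2) + 2 / σ * x) ∂gaussianReal 0 1 =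
      Q (1 / σ) := by
  simp only [Real.exp_add]
  rw [integral_const_mul, setIntegral_exp_mul_gaussianReal _ measurableSet_Iic,
    gaussianReal_real_Iic, ← mul_assoc, ← Real.exp_add]
  have h1 : -(2 / σ ^ 2) + (2 / σ) ^ 2 / 2 = 0 := by field_simp; ring
  have h2 : 2 / σ - 1 / σ = 1 / σ := by ring
  rw [h1, h2, Real.exp_zero, one_mul]

theorem setIntegral_Ioi_exp {σ : ℝ} (hσ : 0 < σ) :
    ∫ x in Set.Ioi (1 / σ), Real.exp (2 / σ ^ 2 + -(2 / σ) * x) ∂gaussianReal 0 1 =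
      Real.exp (4 / σ ^ 2) * Q (3 / σ) := by
  simp only [Real.exp_add]
  rw [integral_const_mul, setIntegral_exp_mul_gaussianReal _ measurableSet_Ioi,
    gaussianReal_real_Ioi, ← mul_assoc, ← Real.exp_add]
  have h1 : 2 / σ ^ 2 + (-(2 / σ)) ^ 2 / 2 = 4 / σ ^ 2 := by field_simp; ring
  have h2 : 1 / σ - -(2 / σ) = 3 / σ := by ring
  rw [h1, h2]

theorem setIntegral_Ioi_affine {σ : ℝ} (hσ : 0 < σ) :
    ∫ x in Set.Ioi (1 / σ), (2 / σ * x - 2 / σ ^ 2) ∂gaussianReal 0 1 =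
      2 / (√(2 * Real.pi) * σ) * Real.exp (-(1 / (2 * σ ^ 2))) - 2 / σ ^ 2 * Q (1 / σ) := by
  rw [integral_sub (integrable_id_gaussianReal.const_mul _).integrableOn
    (integrable_const _).integrableOn, integral_const_mul, setIntegral_Ioi_id_gaussianReal,
    setIntegral_const, smul_eq_mul, ← Q, gaussianPDFReal, NNReal.coe_one, mul_one, sub_zero,
    mul_one]
  have h1 : -(1 / σ) ^ 2 / 2 = -(1 / (2 * σ ^ 2)) := by field_simp
  rw [h1]
  have h2 : √(2 * Real.pi) ≠ 0 := by positivity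
  field_simp

/-- The tangent line at `c` of the concave function `log (1 + u)`; with `c` the mean of `u` it
yields Jensen's inequality. -/
theorem log_one_add_le {c u : ℝ} (hc : 0 ≤ c) (hu : 0 ≤ u) :
    Real.log (1 + u) ≤ Real.log (1 + c) + (u - c) / (1 + c) := by
  have h := Real.log_le_sub_one_of_pos (x := (1 + u) / (1 + c)) (by positivity)
  rw [Real.log_div (by positivity) (by positivity)] at h
  have e : (1 + u) / (1 + c) - 1 = (u - c) / (1 + c) := by field_simp; ring
  linarith

/-- An integrable majorant of the self-information of a bit given its noisy observation. -/
def lossMajorant (σ x : ℝ) : ℝ :=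
  (Set.Ioi (1 / σ)).indicator (fun x => 2 / σ * x - 2 / σ ^ 2) x +
    (Real.log (1 + errorRatio σ) +
      ((Set.Iic (1 / σ)).indicator (fun x => Real.exp (-(2 / σ ^ 2) + 2 / σ * x)) x +
        (Set.Ioi (1 / σ)).indicator (fun x => Real.exp (2 / σ ^ 2 + -(2 / σ) * x)) x -
          errorRatio σ) / (1 + errorRatio σ))

theorem log_one_add_exp_le_lossMajorant {σ : ℝ} (hσ : 0 < σ) (x : ℝ) :
    Real.log (1 + Real.exp (-(2 * (1 - σ * x)) / σ ^ 2)) ≤ lossMajorant σ x := by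
  have e : -(2 * (1 - σ * x)) / σ ^ 2 = -(2 / σ ^ 2) + 2 / σ * x := by field_simp; ring
  rw [e, lossMajorant]
  rcases le_or_gt x (1 / σ) with hx | hx
  · simp only [Set.indicator, Set.mem_Ioi, Set.mem_Iic, hx, not_lt.2 hx, if_true, if_false,
      zero_add, add_zero]
    exact log_one_add_le (errorRatio_nonneg σ) (Real.exp_pos _).le
  · simp only [Set.indicator, Set.mem_Ioi, Set.mem_Iic, hx, not_le.2 hx, if_true, if_false,
      zero_add]
    -- Beyond the threshold the exponent `a` is positive, and `log (1 + exp a) = a + log (1 + exp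
    -- (-a))` leaves a ratio below 1.
    have h1 : 1 + Real.exp (-(2 / σ ^ 2) + 2 / σ * x) = Real.exp (2 / σ * x - 2 / σ ^ 2) *
        (1 + Real.exp (2 / σ ^ 2 + -(2 / σ) * x)) := by
      rw [mul_add, mul_one, ← Real.exp_add, add_comm]
      congr 1
      · congr 1; ring
      · rw [← Real.exp_zero]; congr 1; ring
    rw [h1, Real.log_mul (Real.exp_pos _).ne' (by positivity), Real.log_exp]
    gcongr
    exact log_one_add_le (errorRatio_nonneg σ) (Real.exp_pos _).le

theorem integrable_lossMajorant (σ : ℝ) : Integrable (lossMajorant σ) (gaussianReal 0 1) := by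
  unfold lossMajorant
  refine Integrable.add ?_ ((integrable_const _).add (Integrable.div_const
    ((Integrable.add ?_ ?_).sub (integrable_const _)) _))
  · exact ((integrable_id_gaussianReal.const_mul _).sub (integrable_const _)).indicator
      measurableSet_Ioi
  · exact (integrable_exp_affine_gaussianReal _ _).indicator measurableSet_Iic
  · exact (integrable_exp_affine_gaussianReal _ _).indicator measurableSet_Ioi

theorem integral_add_const_add_div {f g h : ℝ → ℝ} {μ : Measure ℝ} [IsProbabilityMeasure μ]
    (hf : Integrable f μ) (hg : Integrable g μ) (hh : Integrable h μ) (l c d : ℝ) :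
    ∫ x, (f x + (l + (g x + h x - c) / d)) ∂μ =
      ∫ x, f x ∂μ + (l + (∫ x, g x ∂μ + ∫ x, h x ∂μ - c) / d) := by
  have i1 : Integrable (fun x => g x + h x) μ := hg.add hh
  have i2 : Integrable (fun x => g x + h x - c) μ := i1.sub (integrable_const _)
  have i3 : Integrable (fun x => (g x + h x - c) / d) μ := i2.div_const _
  have i4 : Integrable (fun x => l + (g x + h x - c) / d) μ := (integrable_const _).add i3
  rw [integral_add hf i4, integral_add (integrable_const _) i3, integral_div,
    integral_sub i1 (integrable_const _), integral_add hg hh]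
  simp

/-- The two exponential pieces integrate to `errorRatio σ`, the point of tangency, so the linear
correction has mean zero. -/
theorem integral_lossMajorant {σ : ℝ} (hσ : 0 < σ) :
    ∫ x, lossMajorant σ x ∂gaussianReal 0 1 = Real.log 2 * awgnLoss σ := by
  have i1 : Integrable ((Set.Ioi (1 / σ)).indicator fun x => 2 / σ * x - 2 / σ ^ 2)
      (gaussianReal 0 1) :=
    ((integrable_id_gaussianReal.const_mul _).sub (integrable_const _)).indicator
      measurableSet_Ioi
  have i2 : Integrable ((Set.Iic (1 / σ)).indicator fun x =>
      Real.exp (-(2 / σ ^ 2) + 2 / σ * x)) (gaussianReal 0 1) :=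
    (integrable_exp_affine_gaussianReal _ _).indicator measurableSet_Iic
  have i3 : Integrable ((Set.Ioi (1 / σ)).indicator fun x =>
      Real.exp (2 / σ ^ 2 + -(2 / σ) * x)) (gaussianReal 0 1) :=
    (integrable_exp_affine_gaussianReal _ _).indicator measurableSet_Ioi
  simp only [lossMajorant]
  rw [integral_add_const_add_div i1 i2 i3, integral_indicator measurableSet_Ioi,
    integral_indicator measurableSet_Iic, integral_indicator measurableSet_Ioi,
    setIntegral_Iic_exp hσ, setIntegral_Ioi_exp hσ, setIntegral_Ioi_affine hσ,
    log_two_mul_awgnLoss]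
  simp [errorRatio]

theorem log_one_add_exp_nonneg (x : ℝ) : 0 ≤ Real.log (1 + Real.exp x) :=
  Real.log_nonneg (by linarith [Real.exp_pos x])

theorem symbolLoss_le {σ : ℝ} (hσ : 0 < σ) :
    symbolLoss σ ≤ ENNReal.ofReal (Real.log 2 * awgnLoss σ) := by
  rw [← integral_lossMajorant hσ, ofReal_integral_eq_lintegral_ofReal (integrable_lossMajorant σ)
    (Eventually.of_forall fun x => (log_one_add_exp_nonneg _).trans
      (log_one_add_exp_le_lossMajorant hσ x))]
  exact lintegral_mono fun x => ENNReal.ofReal_le_ofReal (log_one_add_exp_le_lossMajorant hσ x)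

/-- Up to the factor `log 2` it is the integral of a majorant of a nonnegative function. -/
theorem awgnLoss_nonneg {σ : ℝ} (hσ : 0 < σ) : 0 ≤ awgnLoss σ := by
  have h : 0 ≤ Real.log 2 * awgnLoss σ := by
    rw [← integral_lossMajorant hσ]
    exact integral_nonneg fun x => (log_one_add_exp_nonneg _).trans
      (log_one_add_exp_le_lossMajorant hσ x)
  exact nonneg_of_mul_nonneg_right h (Real.log_pos one_lt_two)

theorem tendsto_pow_mul_exp_neg_sq (k : ℕ) :
    Tendsto (fun s : ℝ => s ^ k * Real.exp (-(s ^ 2 / 2))) atTop (𝓝 0) := by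
  refine tendsto_of_tendsto_of_tendsto_of_le_of_le' tendsto_const_nhds
    (Real.tendsto_pow_mul_exp_neg_atTop_nhds_zero k) ?_ ?_
  · filter_upwards [eventually_ge_atTop 0] with s hs
    positivity
  · filter_upwards [eventually_ge_atTop 2] with s hs
    refine mul_le_mul_of_nonneg_left (Real.exp_le_exp.2 ?_) (by positivity)
    nlinarith

theorem tendsto_awgnLoss : Tendsto awgnLoss (𝓝[>] 0) (𝓝 0) := by
  have h1 : Tendsto (fun s : ℝ => 2 / √(2 * Real.pi) * (s ^ 1 * Real.exp (-(s ^ 2 / 2)))) atTop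
      (𝓝 0) := by
    simpa using (tendsto_pow_mul_exp_neg_sq 1).const_mul (2 / √(2 * Real.pi))
  have h2 : Tendsto (fun s : ℝ => 2 * (s ^ 2 * Q s)) atTop (𝓝 0) := by
    have : Tendsto (fun s : ℝ => s ^ 2 * Q s) atTop (𝓝 0) := by
      refine tendsto_of_tendsto_of_tendsto_of_le_of_le' tendsto_const_nhds
        (tendsto_pow_mul_exp_neg_sq 2) ?_ ?_
      · exact Eventually.of_forall fun s => mul_nonneg (sq_nonneg s) (Q_nonneg s)
      · filter_upwards [eventually_ge_atTop 0] with s hs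
        exact mul_le_mul_of_nonneg_left (Q_le_exp hs) (sq_nonneg s)
    simpa using this.const_mul 2
  have h0 : Tendsto (fun s : ℝ => Real.exp (-(s ^ 2 / 2))) atTop (𝓝 0) := by
    simpa using tendsto_pow_mul_exp_neg_sq 0
  have h3 : Tendsto Q atTop (𝓝 0) := by
    refine tendsto_of_tendsto_of_tendsto_of_le_of_le' tendsto_const_nhds h0
      (Eventually.of_forall Q_nonneg) ?_
    filter_upwards [eventually_ge_atTop 0] with s hs using Q_le_exp hs
  -- The tail bound gives the exponent `4 s² - 9 s² / 2 = -s² / 2`, where `s` stands for `1 / σ`.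
  have h4 : Tendsto (fun s : ℝ => Real.exp (4 * s ^ 2) * Q (3 * s)) atTop (𝓝 0) := by
    refine tendsto_of_tendsto_of_tendsto_of_le_of_le' tendsto_const_nhds h0
      (Eventually.of_forall fun s => mul_nonneg (Real.exp_pos _).le (Q_nonneg _)) ?_
    filter_upwards [eventually_ge_atTop 0] with s hs
    refine (mul_le_mul_of_nonneg_left (Q_le_exp (by positivity)) (Real.exp_pos _).le).trans ?_
    rw [← Real.exp_add]
    refine Real.exp_le_exp.2 (le_of_eq ?_)
    ring
  have h5 : Tendsto (fun s : ℝ => Real.logb 2 (1 + Q s + Real.exp (4 * s ^ 2) * Q (3 * s))) atTop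
      (𝓝 0) := by
    have h6 := (h3.const_add 1).add h4
    rw [add_zero, add_zero] at h6
    have h7 := (Real.continuousAt_logb (b := 2) one_ne_zero).tendsto.comp h6
    rwa [Real.logb_one] at h7
  have h8 := ((h1.sub h2).const_mul (Real.logb 2 (Real.exp 1))).add h5
  rw [sub_zero, mul_zero, add_zero] at h8
  refine (h8.comp tendsto_inv_nhdsGT_zero).congr' ?_
  filter_upwards [self_mem_nhdsWithin] with σ hσ
  have hσ' : (0 : ℝ) < σ := hσ
  have e1 : 2 / √(2 * Real.pi) * (σ⁻¹ ^ 1 * Real.exp (-(σ⁻¹ ^ 2 / 2))) =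
      2 / (√(2 * Real.pi) * σ) * Real.exp (-(1 / (2 * σ ^ 2))) := by
    have : -(σ⁻¹ ^ 2 / 2) = -(1 / (2 * σ ^ 2)) := by field_simp
    rw [this]
    have h2 : √(2 * Real.pi) ≠ 0 := by positivity
    field_simp
  have e2 : 2 * (σ⁻¹ ^ 2 * Q σ⁻¹) = 2 / σ ^ 2 * Q (1 / σ) := by
    rw [one_div]
    ring
  have e3 : 4 * σ⁻¹ ^ 2 = 4 / σ ^ 2 := by ring
  have e4 : 3 * σ⁻¹ = 3 / σ := by ring
  simp only [Function.comp_apply, awgnLoss]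
  rw [e1, e2, e3, e4, one_div σ]

end Loss

end SyncChannel

end

namespace SyncChannel

/-! ### Capacity achieving laws, output rates and the limit of the bound -/

section OutputRate

variable {β : Type} [MeasurableSpace β]

/-- An error of one bit per block disappears after division by `n`, so the supremum need not be
attained. -/
theorem exists_blockCapacity_le_mutualInfo_add_one (W : ∀ n : ℕ, Kernel (Fin n → Bool) β)
    [∀ n, IsMarkovKernel (W n)] (n : ℕ) :
    ∃ P : PMF (Fin n → Bool), blockCapacity W n ≤ mutualInfo P.toMeasure (W n) + 1 := by
  by_contra! h
  have h0 : blockCapacity W n ≠ 0 := (bot_le.trans_lt (h (PMF.uniformOfFintype _))).ne'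
  have hle : blockCapacity W n ≤ blockCapacity W n - 1 :=
    iSup_le fun P => ENNReal.le_sub_of_add_le_right ENNReal.one_ne_top (h P).le
  exact absurd hle (not_le.2 (ENNReal.sub_lt_self (blockCapacity_ne_top W n) h0 one_ne_zero))

theorem mutualInfo_le_blockCapacity (W : ∀ n : ℕ, Kernel (Fin n → Bool) β) {n : ℕ}
    (P : PMF (Fin n → Bool)) : mutualInfo P.toMeasure (W n) ≤ blockCapacity W n :=
  le_iSup (fun P : PMF (Fin n → Bool) => mutualInfo P.toMeasure (W n)) P

theorem HasCapacity.exists_tendsto_mutualInfo {W : ∀ n : ℕ, Kernel (Fin n → Bool) β}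
    [∀ n, IsMarkovKernel (W n)] {C : ℝ≥0} (hC : HasCapacity W C) :
    ∃ P : ∀ n, PMF (Fin n → Bool),
      Tendsto (fun n => mutualInfo (P n).toMeasure (W n) / (n : ℝ≥0∞)) atTop (𝓝 (C : ℝ≥0∞)) := by
  choose P hP using exists_blockCapacity_le_mutualInfo_add_one W
  refine ⟨P, ?_⟩
  have h1 : Tendsto (fun n : ℕ => blockCapacity W n / (n : ℝ≥0∞) - (n : ℝ≥0∞)⁻¹) atTop
      (𝓝 ((C : ℝ≥0∞) - 0)) :=
    ENNReal.Tendsto.sub hC ENNReal.tendsto_inv_nat_nhds_zero (Or.inl ENNReal.coe_ne_top)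
  rw [tsub_zero] at h1
  refine tendsto_of_tendsto_of_tendsto_of_le_of_le h1 hC (fun n => ?_) fun n =>
    ENNReal.div_le_div_right (mutualInfo_le_blockCapacity W (P n)) _
  dsimp only
  rw [tsub_le_iff_right, ← one_div, ENNReal.div_add_div_same]
  exact ENNReal.div_le_div_right (hP n) _

theorem meanLength_syncChannel_comp_le {p : Bool → PMF (Word Bool)} {L : ℝ≥0∞}
    (hL : ∀ b, meanLength (p b).toMeasure ≤ L) {n : ℕ} (P : PMF (Fin n → Bool)) :
    meanLength (syncChannel p n ∘ₘ P.toMeasure) ≤ L * n := by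
  rw [meanLength_syncChannel_comp]
  refine (lintegral_mono fun x => Finset.sum_le_sum fun i _ => hL (x i)).trans (le_of_eq ?_)
  simp [mul_comm]

theorem meanLength_syncChannel_comp_eq {p : Bool → PMF (Word Bool)} {L : ℝ≥0∞}
    (hL : ∀ b, meanLength (p b).toMeasure = L) {n : ℕ} (P : PMF (Fin n → Bool)) :
    meanLength (syncChannel p n ∘ₘ P.toMeasure) = L * n := by
  rw [meanLength_syncChannel_comp]
  simp [hL, mul_comm]

/-- The normalized mean lengths lie in the compact interval `[0, L]`; a convergent subsequence
suffices, as an output rate may use any block lengths tending to infinity. -/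
theorem HasCapacity.exists_isOutputRate {p : Bool → PMF (Word Bool)} {C : ℝ≥0}
    (hC : HasCapacity (syncChannel p) C) (hp : ∀ b, meanLength (p b).toMeasure ≠ ∞) :
    ∃ r : ℝ≥0, IsOutputRate p C r := by
  obtain ⟨P, hP⟩ := hC.exists_tendsto_mutualInfo
  set L : ℝ≥0∞ := meanLength (p false).toMeasure ⊔ meanLength (p true).toMeasure
  have hL : ∀ b, meanLength (p b).toMeasure ≤ L := fun b => by
    cases b
    · exact le_sup_left
    · exact le_sup_right
  have hLt : L < ∞ := max_lt (lt_top_iff_ne_top.2 (hp false)) (lt_top_iff_ne_top.2 (hp true))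
  obtain ⟨a, ha, φ, hφ, hlim⟩ := (isCompact_Icc (a := (0 : ℝ≥0∞)) (b := L)).tendsto_subseq
    (x := fun n : ℕ => meanLength (syncChannel p n ∘ₘ (P n).toMeasure) / (n : ℝ≥0∞))
    fun n => ⟨bot_le, ENNReal.div_le_of_le_mul (meanLength_syncChannel_comp_le hL (P n))⟩
  refine ⟨a.toNNReal, φ, fun k => P (φ k), hφ.tendsto_atTop, hP.comp hφ.tendsto_atTop, ?_⟩
  rw [ENNReal.coe_toNNReal (ha.2.trans_lt hLt).ne]
  exact hlim

theorem IsOutputRate.eq_of_meanLength_eq {p : Bool → PMF (Word Bool)} {C r l : ℝ≥0}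
    (hl : ∀ b, meanLength (p b).toMeasure = (l : ℝ≥0∞)) (hr : IsOutputRate p C r) : r = l := by
  obtain ⟨n, P, hn, -, hlim⟩ := hr
  have h : Tendsto (fun k => meanLength (syncChannel p (n k) ∘ₘ (P k).toMeasure) /
      (n k : ℝ≥0∞)) atTop (𝓝 (l : ℝ≥0∞)) := by
    refine tendsto_const_nhds.congr' ?_
    filter_upwards [hn.eventually_gt_atTop 0] with k hk
    rw [meanLength_syncChannel_comp_eq hl, ENNReal.mul_div_cancel_right
      (by exact_mod_cast hk.ne') (ENNReal.natCast_ne_top _)]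
  exact_mod_cast tendsto_nhds_unique hlim h

theorem IsOutputRate.sub_awgnLoss_le {p : Bool → PMF (Word Bool)} {σ : ℝ} (hσ : 0 < σ)
    {Cs CAs r : ℝ≥0} (hC : HasCapacity (awgnSyncChannel p σ) CAs) (hr : IsOutputRate p Cs r) :
    (Cs : ℝ) - r * awgnLoss σ ≤ CAs := by
  obtain ⟨n, P, hn, hI, hM⟩ := hr
  have hc : symbolLoss σ / ENNReal.ofReal (Real.log 2) ≤ ENNReal.ofReal (awgnLoss σ) := by
    refine ENNReal.div_le_of_le_mul ((symbolLoss_le hσ).trans (le_of_eq ?_))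
    rw [mul_comm, ENNReal.ofReal_mul (awgnLoss_nonneg hσ)]
  have h1 := (hC.comp hn).add (ENNReal.Tendsto.mul_const (b := ENNReal.ofReal (awgnLoss σ)) hM
    (Or.inr ENNReal.ofReal_ne_top))
  -- The information of the cascade under `P k` is replaced by its block capacity, whose normalized
  -- limit exists along every sequence of block lengths.
  have h2 : (Cs : ℝ≥0∞) ≤ CAs + r * ENNReal.ofReal (awgnLoss σ) := by
    refine le_of_tendsto_of_tendsto' hI h1 fun k => ?_
    refine (ENNReal.div_le_div_right ((mutualInfo_syncChannel_le p σ (P k)).trans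
      (add_le_add (mutualInfo_le_blockCapacity (awgnSyncChannel p σ) (P k))
        (mul_le_mul_right hc _))) _).trans (le_of_eq ?_)
    rw [ENNReal.add_div, Function.comp_apply, ENNReal.mul_div_right_comm]
  have h3 := ENNReal.toReal_mono (by finiteness) h2
  rw [ENNReal.toReal_add (by finiteness) (by finiteness), ENNReal.toReal_mul,
    ENNReal.toReal_ofReal (awgnLoss_nonneg hσ)] at h3
  simp only [ENNReal.coe_toReal] at h3
  linarith

end OutputRate

end SyncChannel

theorem mainTheorem3 (p : Bool → PMF (SyncChannel.Word Bool)) :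
    ∃ Cs : ℝ≥0, SyncChannel.HasCapacity (SyncChannel.syncChannel p) Cs ∧
      -- the lower bound on the capacity of the AWGN/synch channel
      (∀ σ : ℝ, 0 < σ →
        ∃ CAs : ℝ≥0, SyncChannel.HasCapacity (SyncChannel.awgnSyncChannel p σ) CAs ∧
          ∀ r : ℝ≥0, SyncChannel.IsOutputRate p Cs r →
            (CAs : ℝ) ≥ (Cs : ℝ) - (r : ℝ) * SyncChannel.awgnLoss σ) ∧
      -- the bound reduces to `Cs` as the noise vanishes
      (∀ r : ℝ≥0,
        Tendsto (fun σ : ℝ => (Cs : ℝ) - (r : ℝ) * SyncChannel.awgnLoss σ) (𝓝[>] 0)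
          (𝓝 (Cs : ℝ))) ∧
      -- the rate `r` exists if one bit yields finitely many symbols on average
      ((∀ b : Bool, SyncChannel.meanLength (p b).toMeasure ≠ ∞) →
        ∃ r : ℝ≥0, SyncChannel.IsOutputRate p Cs r) ∧
      -- and it is that average if both bits yield the same number of symbols on average
      (∀ l : ℝ≥0, (∀ b : Bool, SyncChannel.meanLength (p b).toMeasure = (l : ℝ≥0∞)) →
        ∀ r : ℝ≥0, SyncChannel.IsOutputRate p Cs r ↔ r = l) := by
  obtain ⟨Cs, hCs⟩ := SyncChannel.exists_hasCapacity (SyncChannel.syncChannel p)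
    SyncChannel.measurable_wordAppend (SyncChannel.isMemoryless_syncChannel p)
  refine ⟨Cs, hCs, fun σ hσ => ?_, fun r => ?_, hCs.exists_isOutputRate, fun l hl r =>
    ⟨SyncChannel.IsOutputRate.eq_of_meanLength_eq hl, ?_⟩⟩
  · obtain ⟨CAs, hCAs⟩ := SyncChannel.exists_hasCapacity (SyncChannel.awgnSyncChannel p σ)
      SyncChannel.measurable_wordAppend (SyncChannel.isMemoryless_awgnSyncChannel p σ)
    exact ⟨CAs, hCAs, fun r hr => hr.sub_awgnLoss_le hσ hCAs⟩
  · simpa using (SyncChannel.tendsto_awgnLoss.const_mul (r : ℝ)).const_sub (Cs : ℝ)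
  · rintro rfl
    -- Some output rate exists, and uniqueness forces it to equal the common mean length.
    obtain ⟨r', hr'⟩ := hCs.exists_isOutputRate fun b => by rw [hl b]; exact ENNReal.coe_ne_top
    rwa [SyncChannel.IsOutputRate.eq_of_meanLength_eq hl hr'] at hr'
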